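/- Let $X$ be a real inner product space and let $D=\{(x_i,y_i): i=1,\dots,\ell\}$, with $x_i\in X$ and $y_i\in\{-1,+1\}$, be a finite data set that is linearly separable with margin $\gamma>0$; that is, there are $w\in X$ with $\|w\|=1$ and $b\in\mathbb{R}$ such that $y_i(\langle w,x_i\rangle+b)\ge\gamma$ for all $i$. For a finite training sample $S$ of labelled points and a penalty $C\in(0,\infty]$, an SVM trained on $S$ is a classifier $\Psi_S(x)=\operatorname{sign}(\langle w,x\rangle+b)$ (with $\operatorname{sign}(0)=+1$), where $(w,b)$ minimizes $\tfrac12\|w\|^2+C\sum_{(x,y)\in S}\max(0,\,1-y(\langle w,x\rangle+b))^2$; for $C=\infty$ this is the hard-margin (max-margin) SVM: $(w,b)$ minimizes $\tfrac12\|w\|^2$ subject to $y(\langle w,x\rangle+b)\ge 1$ for all $(x,y)\in S$. Fix $C\in(0,\infty]$. Then for all $0<\delta<\tfrac12$ and $0<\theta<\tfrac12$ there is a positive integer $r$ such that $D$ is $r$-regular at $(\delta,\theta)$. That is, for every probability distribution $\mathcal{D}_*$ over $D$ and every $s\ge r$: with probability at least $1-\delta$ over a sample $S$ of $s$ points drawn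 iid from $\mathcal{D}_*$, an SVM $\Psi_S$ trained on $S$ exists, and every such $\Psi_S$ satisfies $\Pr_{(x,y)\sim\mathcal{D}_*}[\Psi_S(x)\neq y]\le\theta$. -/

import Mathlib

open MeasureTheory
open scoped ENNReal

noncomputable section

/-- A labelled example: a feature vector and a label in `{-1, +1}`. -/
abbrev LabelledPoint (X : Type*) := X × ℤˣ

/-- An affine function `x ↦ ⟪w, x⟫ + b`, given by its weight vector and its offset. -/
structure AffineFn (X : Type*) where
  w : X
  b : ℝ

section

variable {X : Type*} [NormedAddCommGroup X] [InnerProductSpace ℝ X]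

/-- The value `⟪w, x⟫ + b`. -/
def AffineFn.eval (f : AffineFn X) (x : X) : ℝ := inner ℝ f.w x + f.b

/-- The binary classifier obtained by thresholding an affine function at `0`. -/
def AffineFn.classify (f : AffineFn X) (x : X) : ℤˣ := if 0 ≤ f.eval x then 1 else -1

/-- The functional margin `y * f x` of `f` at a labelled example `(x, y)`. -/
def AffineFn.marginAt (f : AffineFn X) (z : LabelledPoint X) : ℝ := ((z.2 : ℤ) : ℝ) * f.eval z.1

/-- The data set `D` is linearly separable with margin `γ > 0`: some hyperplane with unit normal
vector has every example on its correct side, at distance at least `γ`. -/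
def SeparableWithMargin {ℓ : ℕ} (D : Fin ℓ → LabelledPoint X) (γ : ℝ) : Prop :=
  0 < γ ∧ ∃ f : AffineFn X, ‖f.w‖ = 1 ∧ ∀ i, γ ≤ f.marginAt (D i)

/-- The slack `max (0, 1 - y * f x)` of `f` at a labelled example. -/
def AffineFn.slack (f : AffineFn X) (z : LabelledPoint X) : ℝ := max 0 (1 - f.marginAt z)

/-- The primal objective `‖w‖² / 2 + C * ∑ ξ²` of the 2-norm SVM with penalty `C ∈ [0, ∞]` on the
training sample `S`. For `C = ∞` it is `‖w‖² / 2` if `1 ≤ y * f x` for all `(x, y)` in `S`, and `∞`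
otherwise (as `∞ * 0 = 0`), which is the objective of the hard-margin (max-margin) SVM. -/
def svmObjective (C : ℝ≥0∞) {s : ℕ} (S : Fin s → LabelledPoint X) (f : AffineFn X) : ℝ≥0∞ :=
  ENNReal.ofReal (‖f.w‖ ^ 2 / 2) + C * ∑ j, ENNReal.ofReal (f.slack (S j) ^ 2)

/-- `f` is a trained SVM on `S`: a feasible minimizer of the SVM objective. -/
def IsSVM (C : ℝ≥0∞) {s : ℕ} (S : Fin s → LabelledPoint X) (f : AffineFn X) : Prop :=
  svmObjective C S f ≠ ∞ ∧ ∀ g : AffineFn X, svmObjective C S f ≤ svmObjective C S g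

/-- The expected error rate of the classifier of `f` on a test example `D i`, with `i` drawn
from `P`. -/
def errorRate {ℓ : ℕ} (D : Fin ℓ → LabelledPoint X) (P : PMF (Fin ℓ)) (f : AffineFn X) : ℝ≥0∞ :=
  P.toMeasure {i | f.classify (D i).1 ≠ (D i).2}

/-- `D` is `r`-regular at `(δ, θ)`, for the SVM with penalty `C`: for every probability
distribution `P` over `D` and every `s ≥ r`, with probability at least `1 - δ` over `s` iid draws
from `P`, the SVM of the drawn sample exists and has expected error rate at most `θ` under `P`
(whichever minimizer is returned, when there are several). -/
def IsDataRegular (C : ℝ≥0∞) {ℓ : ℕ} (D : Fin ℓ → LabelledPoint X) (r : ℕ) (δ θ : ℝ) : Prop :=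
  ∀ P : PMF (Fin ℓ), ∀ s : ℕ, r ≤ s →
    ENNReal.ofReal (1 - δ) ≤ Measure.pi (fun _ : Fin s => P.toMeasure)
      {σ : Fin s → Fin ℓ |
        (∃ f : AffineFn X, IsSVM C (fun j => D (σ j)) f) ∧
        ∀ f : AffineFn X, IsSVM C (fun j => D (σ j)) f →
          errorRate D P f ≤ ENNReal.ofReal θ}

end

end

/-!
Rescaling a separator of margin `γ` gives one affine function with functional margin at least `1` on
all of `D`. Its objective is the same number `‖w‖² / 2` whatever the sample is, so a trained SVM has
objective at most this number. A misclassified example has slack at least `1`, so it contributes at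
least `C` to the objective each time it occurs in the sample. Hence there is a count `K`, independent
of the sample, such that an example occurring `K` times is classified correctly
(`AffineFn.classify_eq_of_le_card`); for `C = ∞` one occurrence is enough.

Examples of mass at most `θ / ℓ` have total mass at most `θ`, so it remains to see each of the other,
heavy examples `K` times with probability `1 - δ`. Cut `K * m` of the draws into `K` blocks of `m`
draws. A block misses a given heavy example with probability at most `(1 - θ / ℓ) ^ m`, and by a union
bound over examples and blocks this suffices for large `m`
(`measure_exists_card_lt_le`).

A minimizer exists (`exists_isSVM`) although `X` need not be complete: projecting the weight vector
onto the span of the sample does not increase the objective, and on this finite-dimensional space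
the objective is lower semicontinuous and, when both labels occur, its sublevel sets are bounded. With
a single label, a constant function has objective `0`.
-/

section

variable {X : Type*} [NormedAddCommGroup X] [InnerProductSpace ℝ X]

/-! ### Misclassification and the objective -/

theorem AffineFn.one_le_slack_of_classify_ne {f : AffineFn X} {z : LabelledPoint X}
    (h : f.classify z.1 ≠ z.2) : 1 ≤ f.slack z := by
  refine le_max_of_le_right ?_
  unfold AffineFn.classify at h
  unfold AffineFn.marginAt
  rcases Int.units_eq_one_or z.2 with hz | hz <;> rw [hz] at h ⊢ <;> split_ifs at h with h0
  · exact absurd rfl h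
  · push_cast
    linarith
  · push_cast
    linarith
  · exact absurd rfl h

theorem AffineFn.slack_eq_zero {f : AffineFn X} {z : LabelledPoint X} (h : 1 ≤ f.marginAt z) :
    f.slack z = 0 :=
  max_eq_left (by linarith)

theorem svmObjective_of_one_le_marginAt (C : ℝ≥0∞) {s : ℕ} (S : Fin s → LabelledPoint X)
    {f : AffineFn X} (h : ∀ j, 1 ≤ f.marginAt (S j)) :
    svmObjective C S f = ENNReal.ofReal (‖f.w‖ ^ 2 / 2) := by
  simp [svmObjective, AffineFn.slack_eq_zero (h _)]

theorem SeparableWithMargin.exists_one_le_marginAt {ℓ : ℕ} {D : Fin ℓ → LabelledPoint X} {γ : ℝ}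
    (hD : SeparableWithMargin D γ) : ∃ f : AffineFn X, ∀ i, 1 ≤ f.marginAt (D i) := by
  obtain ⟨hγ, f, -, hf⟩ := hD
  refine ⟨⟨γ⁻¹ • f.w, γ⁻¹ * f.b⟩, fun i => ?_⟩
  have h : AffineFn.marginAt ⟨γ⁻¹ • f.w, γ⁻¹ * f.b⟩ (D i) = γ⁻¹ * f.marginAt (D i) := by
    simp only [AffineFn.marginAt, AffineFn.eval, real_inner_smul_left]
    ring
  rw [h]
  calc (1 : ℝ) = γ⁻¹ * γ := (inv_mul_cancel₀ hγ.ne').symm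
    _ ≤ γ⁻¹ * f.marginAt (D i) := by gcongr; exact hf i

/-- An example that occurs `K` times in the sample is classified correctly by every affine function
whose objective is less than `C * K`. -/
theorem AffineFn.classify_eq_of_le_card {C : ℝ≥0∞} {ℓ s K : ℕ} {D : Fin ℓ → LabelledPoint X}
    {σ : Fin s → Fin ℓ} {f : AffineFn X} (hf : svmObjective C (fun j => D (σ j)) f < C * K)
    {i : Fin ℓ} (hi : K ≤ (Finset.univ.filter fun j => σ j = i).card) :
    f.classify (D i).1 = (D i).2 := by
  by_contra h
  refine hf.not_ge (le_add_left ?_)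
  gcongr
  calc (K : ℝ≥0∞) ≤ ((Finset.univ.filter fun j => σ j = i).card : ℝ≥0∞) := by exact_mod_cast hi
    _ = ∑ j ∈ Finset.univ.filter fun j => σ j = i, 1 := by simp
    _ ≤ ∑ j ∈ Finset.univ.filter fun j => σ j = i, ENNReal.ofReal (f.slack (D (σ j)) ^ 2) := by
        refine Finset.sum_le_sum fun j hj => ?_
        rw [(Finset.mem_filter.mp hj).2, ENNReal.one_le_ofReal]
        exact one_le_pow₀ (one_le_slack_of_classify_ne h)
    _ ≤ ∑ j, ENNReal.ofReal (f.slack (D (σ j)) ^ 2) :=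
        Finset.sum_le_sum_of_subset (Finset.filter_subset _ _)

/-! ### Existence of trained SVMs -/

theorem ENNReal.lowerSemicontinuous_const_mul {α : Type*} [TopologicalSpace α] (C : ℝ≥0∞)
    {g : α → ℝ≥0∞} (hg : Continuous g) : LowerSemicontinuous fun x => C * g x := by
  rcases eq_or_ne C ∞ with rfl | hC
  · -- `∞ * a` is the supremum of the continuous functions `n * a`
    have h : (fun x => ∞ * g x) = fun x => ⨆ n : ℕ, (n : ℝ≥0∞) * g x := by
      funext x
      rw [← ENNReal.iSup_mul, ENNReal.iSup_natCast]
    rw [h]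
    exact lowerSemicontinuous_iSup fun n =>
      ((ENNReal.continuous_const_mul (ENNReal.natCast_ne_top n)).comp hg).lowerSemicontinuous
  · exact ((ENNReal.continuous_const_mul hC).comp hg).lowerSemicontinuous

theorem lowerSemicontinuous_svmObjective (C : ℝ≥0∞) {s : ℕ} (S : Fin s → LabelledPoint X)
    (V : Submodule ℝ X) :
    LowerSemicontinuous fun p : V × ℝ => svmObjective C S ⟨p.1, p.2⟩ := by
  refine LowerSemicontinuous.add (Continuous.lowerSemicontinuous ?_)
    (ENNReal.lowerSemicontinuous_const_mul C ?_)
  · refine ENNReal.continuous_ofReal.comp ?_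
    fun_prop
  · refine continuous_finsetSum _ fun j _ => ENNReal.continuous_ofReal.comp ?_
    simp only [AffineFn.slack, AffineFn.marginAt, AffineFn.eval]
    fun_prop

/-- Projecting the weight vector onto a subspace containing the sample leaves all slacks unchanged
and does not increase the norm. -/
theorem svmObjective_starProjection_le (C : ℝ≥0∞) {s : ℕ} (S : Fin s → LabelledPoint X)
    (V : Submodule ℝ X) [V.HasOrthogonalProjection] (hV : ∀ j, (S j).1 ∈ V) (f : AffineFn X) :
    svmObjective C S ⟨V.starProjection f.w, f.b⟩ ≤ svmObjective C S f := by
  have h : ∀ j, AffineFn.slack ⟨V.starProjection f.w, f.b⟩ (S j) = f.slack (S j) := fun j => by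
    simp only [AffineFn.slack, AffineFn.marginAt, AffineFn.eval]
    rw [Submodule.inner_starProjection_left_eq_right,
      Submodule.starProjection_eq_self_iff.mpr (hV j)]
  simp only [svmObjective, h]
  gcongr
  exact V.norm_starProjection_apply_le f.w

theorem norm_le_of_svmObjective_le {C M : ℝ≥0∞} (hM : M ≠ ∞) {s : ℕ}
    {S : Fin s → LabelledPoint X} {f : AffineFn X} (h : svmObjective C S f ≤ M) :
    ‖f.w‖ ≤ 2 * M.toReal + 1 := by
  have h1 : ‖f.w‖ ^ 2 / 2 ≤ M.toReal :=
    (ENNReal.ofReal_le_iff_le_toReal hM).mp (le_self_add.trans h)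
  nlinarith [sq_nonneg (‖f.w‖ - 1)]

theorem slack_le_of_svmObjective_le {C M : ℝ≥0∞} (hC : C ≠ 0) (hM : M ≠ ∞) {s : ℕ}
    {S : Fin s → LabelledPoint X} {f : AffineFn X} (h : svmObjective C S f ≤ M) (j : Fin s) :
    f.slack (S j) ≤ (M / C).toReal + 1 := by
  have h1 : ENNReal.ofReal (f.slack (S j) ^ 2) ≤ M / C := by
    rw [ENNReal.le_div_iff_mul_le (.inl hC) (.inr hM), mul_comm]
    refine le_trans ?_ (le_add_self.trans h)
    gcongr
    exact Finset.single_le_sum (f := fun j => ENNReal.ofReal (f.slack (S j) ^ 2))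
      (fun _ _ => zero_le) (Finset.mem_univ j)
  have h2 := (ENNReal.ofReal_le_iff_le_toReal (ENNReal.div_ne_top hM hC)).mp h1
  nlinarith [sq_nonneg (f.slack (S j) - 1)]

/-- When both labels occur in the sample, the offsets of affine functions with bounded objective are
bounded. -/
theorem exists_abs_b_le_of_svmObjective_le {C M : ℝ≥0∞} (hC : C ≠ 0) (hM : M ≠ ∞) {s : ℕ}
    {S : Fin s → LabelledPoint X} (hpos : ∃ j, (S j).2 = 1) (hneg : ∃ j, (S j).2 = -1) :
    ∃ B, ∀ f : AffineFn X, svmObjective C S f ≤ M → |f.b| ≤ B := by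
  obtain ⟨j, hj⟩ := hpos
  obtain ⟨k, hk⟩ := hneg
  set R := 2 * M.toReal + 1 with hR
  set L := (M / C).toReal + 1 with hL
  have hR0 : 0 ≤ R := by positivity
  refine ⟨L + R * ‖(S j).1‖ + R * ‖(S k).1‖, fun f hf => ?_⟩
  have hin : ∀ x : X, |inner ℝ f.w x| ≤ R * ‖x‖ := fun x =>
    (abs_real_inner_le_norm _ _).trans
      (mul_le_mul_of_nonneg_right (norm_le_of_svmObjective_le hM hf) (norm_nonneg x))
  have h1 := (le_max_right _ _).trans (slack_le_of_svmObjective_le hC hM hf j)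
  have h2 := (le_max_right _ _).trans (slack_le_of_svmObjective_le hC hM hf k)
  simp only [AffineFn.marginAt, AffineFn.eval, hj, hk] at h1 h2
  push_cast at h1 h2
  have h3 := abs_le.mp (hin (S j).1)
  have h4 := abs_le.mp (hin (S k).1)
  have h5 := mul_nonneg hR0 (norm_nonneg (S j).1)
  have h6 := mul_nonneg hR0 (norm_nonneg (S k).1)
  exact abs_le.mpr ⟨by linarith, by linarith⟩

theorem exists_isSVM_of_forall_label_eq (C : ℝ≥0∞) {s : ℕ} {S : Fin s → LabelledPoint X} {y : ℤˣ}
    (hy : ∀ j, (S j).2 = y) : ∃ f : AffineFn X, IsSVM C S f := by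
  have h : svmObjective C S ⟨0, ((y : ℤ) : ℝ)⟩ = 0 := by
    rw [svmObjective_of_one_le_marginAt]
    · simp
    · intro j
      rcases Int.units_eq_one_or y with rfl | rfl <;>
        simp [AffineFn.marginAt, AffineFn.eval, hy j]
  exact ⟨⟨0, ((y : ℤ) : ℝ)⟩, by simp [h], fun g => by simp [h]⟩

/-- A trained SVM exists on every sample on which some affine function has finite objective. -/
theorem exists_isSVM {C : ℝ≥0∞} (hC : C ≠ 0) {s : ℕ} (S : Fin s → LabelledPoint X)
    {f₀ : AffineFn X} (h₀ : svmObjective C S f₀ ≠ ∞) : ∃ f : AffineFn X, IsSVM C S f := by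
  by_cases hneg : ∃ j, (S j).2 = -1
  swap
  · exact exists_isSVM_of_forall_label_eq C (y := 1) fun j =>
      (Int.units_eq_one_or _).resolve_right fun h => hneg ⟨j, h⟩
  by_cases hpos : ∃ j, (S j).2 = 1
  swap
  · exact exists_isSVM_of_forall_label_eq C (y := -1) fun j =>
      (Int.units_eq_one_or _).resolve_left fun h => hpos ⟨j, h⟩
  obtain ⟨B, hB⟩ := exists_abs_b_le_of_svmObjective_le (X := X) hC h₀ hpos hneg
  let V : Submodule ℝ X := Submodule.span ℝ (Set.range fun j => (S j).1)
  have hV : ∀ j, (S j).1 ∈ V := fun j => Submodule.subset_span ⟨j, rfl⟩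
  have : FiniteDimensional ℝ V := FiniteDimensional.span_of_finite ℝ (Set.finite_range _)
  have : ProperSpace V := FiniteDimensional.proper_real V
  let A : Set (V × ℝ) :=
    Metric.closedBall 0 (2 * (svmObjective C S f₀).toReal + 1) ×ˢ Set.Icc (-B) B
  have hA : IsCompact A := (isCompact_closedBall _ _).prod isCompact_Icc
  let proj : AffineFn X → V × ℝ := fun g => (V.orthogonalProjectionOnto g.w, g.b)
  have hproj : ∀ g, svmObjective C S ⟨(proj g).1, (proj g).2⟩ ≤ svmObjective C S g :=
    svmObjective_starProjection_le C S V hV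
  have hmem : ∀ g, svmObjective C S g ≤ svmObjective C S f₀ → proj g ∈ A := fun g hg => by
    have h := (hproj g).trans hg
    exact ⟨mem_closedBall_zero_iff.mpr (norm_le_of_svmObjective_le h₀ h), abs_le.mp (hB g hg)⟩
  obtain ⟨p, -, hp⟩ := ((lowerSemicontinuous_svmObjective C S V).lowerSemicontinuousOn
    A).exists_isMinOn ⟨_, hmem f₀ le_rfl⟩ hA
  have hle : ∀ g, svmObjective C S g ≤ svmObjective C S f₀ →
      svmObjective C S ⟨p.1, p.2⟩ ≤ svmObjective C S g := fun g hg =>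
    (isMinOn_iff.mp hp _ (hmem g hg)).trans (hproj g)
  have hp₀ := hle f₀ le_rfl
  exact ⟨⟨p.1, p.2⟩, ne_top_of_le_ne_top h₀ hp₀, fun g =>
    (le_total (svmObjective C S g) (svmObjective C S f₀)).elim (hle g) hp₀.trans⟩

/-! ### Error rate from heavy examples -/

theorem errorRate_le_of_classify_eq {ℓ : ℕ} {D : Fin ℓ → LabelledPoint X} {P : PMF (Fin ℓ)}
    {f : AffineFn X} {θ : ℝ} (hθ : 0 ≤ θ)
    (h : ∀ i, ENNReal.ofReal (θ / ℓ) < P i → f.classify (D i).1 = (D i).2) :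
    errorRate D P f ≤ ENNReal.ofReal θ := by
  unfold errorRate
  rw [PMF.toMeasure_apply_fintype]
  calc ∑ i, Set.indicator {i | f.classify (D i).1 ≠ (D i).2} P i
      ≤ ∑ _i : Fin ℓ, ENNReal.ofReal (θ / ℓ) := by
        refine Finset.sum_le_sum fun i _ => ?_
        by_cases hi : f.classify (D i).1 = (D i).2
        · simp [hi]
        · exact (Set.indicator_le_self _ _ i).trans (not_lt.mp fun hlt => hi (h i hlt))
    _ = ENNReal.ofReal (ℓ * (θ / ℓ)) := by
        rw [Finset.sum_const, Finset.card_univ, Fintype.card_fin, nsmul_eq_mul,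
          ENNReal.ofReal_mul (Nat.cast_nonneg ℓ), ENNReal.ofReal_natCast]
    _ ≤ ENNReal.ofReal θ := by
        gcongr
        rcases eq_or_ne (ℓ : ℝ) 0 with h0 | h0
        · simpa [h0] using hθ
        · rw [mul_div_cancel₀ θ h0]

end

/-! ### Repeated occurrence of heavy points in iid samples -/

/-- The probability that all draws in a given block avoid a point of mass greater than `ε`. -/
theorem measure_forall_mem_ne_le {ℓ s : ℕ} (P : PMF (Fin ℓ)) {ε : ℝ≥0∞} {i : Fin ℓ} (hi : ε < P i)
    (T : Finset (Fin s)) :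
    Measure.pi (fun _ : Fin s => P.toMeasure) {σ | ∀ j ∈ T, σ j ≠ i} ≤ (1 - ε) ^ T.card := by
  have hset : {σ : Fin s → Fin ℓ | ∀ j ∈ T, σ j ≠ i} =
      Set.univ.pi fun j => if j ∈ T then {i}ᶜ else Set.univ := by
    ext σ
    simp only [Set.mem_ofPred_eq, Set.mem_univ_pi]
    refine forall_congr' fun j => ?_
    split_ifs with h <;> simp [h]
  have hi' : P.toMeasure ({i}ᶜ) ≤ 1 - ε := by
    rw [prob_compl_eq_one_sub (measurableSet_singleton i),
      PMF.toMeasure_apply_singleton _ _ (measurableSet_singleton i)]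
    gcongr
  rw [hset, Measure.pi_pi]
  calc ∏ j, P.toMeasure (if j ∈ T then {i}ᶜ else Set.univ)
      = ∏ j, if j ∈ T then P.toMeasure {i}ᶜ else 1 :=
        Finset.prod_congr rfl fun j _ => by split_ifs <;> simp
    _ = P.toMeasure {i}ᶜ ^ T.card := by
        rw [Finset.prod_ite_mem, Finset.univ_inter, Finset.prod_const]
    _ ≤ (1 - ε) ^ T.card := by gcongr

/-- Among `K * m` or more draws, some point of mass greater than `ε` occurs fewer than `K` times
with probability at most `ℓ * K * (1 - ε) ^ m`. -/
theorem measure_exists_card_lt_le {ℓ s K m : ℕ} (hs : K * m ≤ s) (P : PMF (Fin ℓ)) (ε : ℝ≥0∞) :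
    Measure.pi (fun _ : Fin s => P.toMeasure)
      {σ | ∃ i, ε < P i ∧ (Finset.univ.filter fun j => σ j = i).card < K} ≤
      ℓ * K * (1 - ε) ^ m := by
  obtain ⟨e⟩ : Nonempty (Fin K × Fin m ↪ Fin s) :=
    Function.Embedding.nonempty_of_card_le (by simpa using hs)
  let block : Fin K → Finset (Fin s) := fun k =>
    Finset.univ.map ⟨fun a => e (k, a), fun a b h => (Prod.mk.inj (e.injective h)).2⟩
  have hcard : ∀ k, (block k).card = m := fun k => by simp [block]
  -- a point that occurs in all `K` disjoint blocks occurs at least `K` times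
  have hsub : {σ : Fin s → Fin ℓ |
      ∃ i, ε < P i ∧ (Finset.univ.filter fun j => σ j = i).card < K} ⊆
      ⋃ i : Fin ℓ, ⋃ k : Fin K, {σ | ε < P i ∧ ∀ j ∈ block k, σ j ≠ i} := by
    rintro σ ⟨i, hi, hlt⟩
    simp only [Set.mem_iUnion, Set.mem_ofPred_eq]
    by_contra! hcon
    have hex : ∀ k, ∃ a, σ (e (k, a)) = i := fun k => by
      obtain ⟨j, hj, hji⟩ := hcon i k hi
      obtain ⟨a, -, rfl⟩ := Finset.mem_map.mp hj
      exact ⟨a, hji⟩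
    choose a ha using hex
    refine hlt.not_ge ?_
    calc K = (Finset.univ : Finset (Fin K)).card := by simp
      _ ≤ _ := Finset.card_le_card_of_injOn (fun k => e (k, a k)) (fun k _ => by simp [ha k])
          fun k _ k' _ h => (Prod.mk.inj (e.injective h)).1
  calc _ ≤ Measure.pi (fun _ : Fin s => P.toMeasure)
          (⋃ i : Fin ℓ, ⋃ k : Fin K, {σ | ε < P i ∧ ∀ j ∈ block k, σ j ≠ i}) :=
        measure_mono hsub
    _ ≤ ∑ i : Fin ℓ, ∑ k : Fin K, Measure.pi (fun _ : Fin s => P.toMeasure)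
          {σ | ε < P i ∧ ∀ j ∈ block k, σ j ≠ i} :=
        (measure_iUnion_fintype_le _ _).trans
          (Finset.sum_le_sum fun i _ => measure_iUnion_fintype_le _ _)
    _ ≤ ∑ _i : Fin ℓ, ∑ _k : Fin K, (1 - ε) ^ m := by
        refine Finset.sum_le_sum fun i _ => Finset.sum_le_sum fun k _ => ?_
        by_cases hi : ε < P i
        · simpa [hi, hcard k] using measure_forall_mem_ne_le P hi (block k)
        · simp [hi]
    _ = ℓ * K * (1 - ε) ^ m := by simp [mul_assoc]

theorem exists_mul_one_sub_pow_le {ε c δ : ℝ≥0∞} (hε : ε ≠ 0) (hc : c ≠ ∞) (hδ : 0 < δ) :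
    ∃ m : ℕ, c * (1 - ε) ^ m ≤ δ := by
  have h1 : (1 : ℝ≥0∞) - ε < 1 := ENNReal.sub_lt_self ENNReal.one_ne_top one_ne_zero hε
  have h2 := ENNReal.Tendsto.const_mul (ENNReal.tendsto_pow_atTop_nhds_zero_of_lt_one h1)
    (.inr hc)
  rw [mul_zero] at h2
  exact ((h2.eventually_lt_const hδ).mono fun _ h => h.le).exists

/-! ### Regularity of separable data sets -/

theorem mainTheorem3 {X : Type*} [NormedAddCommGroup X] [InnerProductSpace ℝ X]
    (C : ℝ≥0∞) (hC : 0 < C)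
    {ℓ : ℕ} (D : Fin ℓ → LabelledPoint X) (γ : ℝ) (hD : SeparableWithMargin D γ)
    (δ θ : ℝ) (hδ : 0 < δ) (hδ' : δ < 1 / 2) (hθ : 0 < θ) (hθ' : θ < 1 / 2) :
    ∃ r : ℕ, 0 < r ∧ IsDataRegular C D r δ θ := by
  rcases Nat.eq_zero_or_pos ℓ with rfl | hℓ
  · -- there is no probability distribution on an empty data set
    exact ⟨1, one_pos, fun P => P.support_nonempty.some.elim0⟩
  obtain ⟨f₀, hf₀⟩ := hD.exists_one_le_marginAt
  obtain ⟨K, hK⟩ : ∃ K : ℕ, ENNReal.ofReal (‖f₀.w‖ ^ 2 / 2) < C * K := by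
    obtain ⟨K, hK⟩ := ENNReal.exists_nat_mul_gt hC.ne'
      (ENNReal.ofReal_ne_top (r := ‖f₀.w‖ ^ 2 / 2))
    exact ⟨K, by rwa [mul_comm]⟩
  obtain ⟨m, hm⟩ := exists_mul_one_sub_pow_le (ε := ENNReal.ofReal (θ / ℓ)) (c := ℓ * K)
    (ENNReal.ofReal_pos.mpr (by positivity)).ne'
    (ENNReal.mul_ne_top (ENNReal.natCast_ne_top _) (ENNReal.natCast_ne_top _))
    (ENNReal.ofReal_pos.mpr hδ)
  refine ⟨K * m + 1, Nat.succ_pos _, fun P s hs => ?_⟩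
  have hbad := (measure_exists_card_lt_le ((Nat.le_succ _).trans hs) P
    (ENNReal.ofReal (θ / ℓ))).trans hm
  rw [ENNReal.ofReal_sub _ hδ.le, ENNReal.ofReal_one]
  refine (tsub_le_tsub_left hbad 1).trans ?_
  rw [← prob_compl_eq_one_sub (Set.toFinite _).measurableSet]
  refine measure_mono fun σ hσ => ?_
  have hobj : svmObjective C (fun j => D (σ j)) f₀ = ENNReal.ofReal (‖f₀.w‖ ^ 2 / 2) :=
    svmObjective_of_one_le_marginAt C _ fun j => hf₀ (σ j)
  refine ⟨exists_isSVM hC.ne' _ (hobj ▸ ENNReal.ofReal_ne_top), fun f hf => ?_⟩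
  refine errorRate_le_of_classify_eq hθ.le fun i hi => ?_
  refine AffineFn.classify_eq_of_le_card (((hf.2 f₀).trans_eq hobj).trans_lt hK) ?_
  exact not_lt.mp fun hlt => hσ ⟨i, hi, hlt⟩
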